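/- **Model.** Consider a two-tier cellular network in the plane with small base stations (SBS) and macro base stations (MBS) placed according to independent homogeneous Poisson point processes of densities $\lambda_s>0$ and $\lambda_m>0$; the MBSs seen from a typical SBS (placed at the origin of its own coordinates) also form a homogeneous Poisson point process of density $\lambda_m$. A link of length $r$ is line-of-sight (LoS, $\mathrm L$) with probability $\mathcal P_{\mathrm L}(r)=\min(18/r,1)(1-e^{-\beta r})+e^{-\beta r}$, $\beta\ge 0$, and non-line-of-sight (NLoS, $\mathrm{NL}$) otherwise, independently over the links; its path gain is $L(r)=A_{\mathrm L}r^{-\alpha_{\mathrm L}}$, respectively $L(r)=A_{\mathrm{NL}}r^{-\alpha_{\mathrm{NL}}}$, with $A_{\mathrm L},A_{\mathrm{NL}},\alpha_{\mathrm L},\alpha_{\mathrm{NL}}>0$. The small-scale fadings $h$ are independent exponential variables of mean $1$. Each MBS stores the whole library of $F$ files and each SBS stores the $C$ most popular files, $0\le C<F$; the transmit powers are $P_s^{tr}=(P_s^{tot}-P_s^{fc}-w_{ca}C)/\rho_s\ge 0$ and $P_m^{tr}=(P_m^{tot}-P_m^{fc}-w_{ca}F)/\rho_m>0$, where $\rho_s,\rho_m>0$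 and $P_s^{fc},P_m^{fc},w_{ca}\ge 0$. The association biases are $B_s,B_m>0$ and the noise power is $N_0>0$. A file requested at random has rank $f\in\{1,\dots,F\}$ with probability $f^{-\gamma_p}/\sum_{g=1}^F g^{-\gamma_p}$, $\gamma_p\ge 0$. **Association and coverage.** The typical user, at the origin, is served by the station of either tier with the largest biased received power $P_k^{tr}B_k h L(r)$; the typical SBS is served on the backhaul by the MBS with the largest biased received power. (The same result is asserted if the fading $h$ in the selection rule is replaced by its mean $1$.) If the user is served by an SBS, $\mathrm{SINR}_s$ is the power $P_s^{tr}B_shL(r)$ received from that SBS divided by the sum of $N_0$ and the powers $P_k^{tr}B_khL$ received from all other SBSs and all MBSs; $\mathrm{SINR}_{bh}$ is the power $P_m^{tr}B_mhL(r)$ received by the typical SBS from its serving MBS divided by the sum of $N_0$ and the powers received from all other MBSs. For $a,b\in\{\mathrm L,\mathrm{NL}\}$ let $P^{cov}_{s,a}(\gamma)$ be the probability that the typical user is associated with an SBS over a link of type $a$ and $\mathrm{SINR}_s\ge\gamma$, and let $P^{cov}_{bh,b}(\gamma)$ be the probability that the typical SBS is associated with an MBS over a link of type $b$ and $\mathrm{SINR}_{bh}\ge\gamma$.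 **Throughput.** The bandwidth $W>0$ is split into $\eta W$ for access links and $(1-\eta)W$ for backhaul links, $\eta\in[0,1]$. Links of density $\lambda$, bandwidth $w$ and coverage probability $P$ at the SINR threshold $\gamma_0\ge 0$ have average potential throughput (APT) $\lambda w\log_2(1+\gamma_0)P$. The APT $\mathcal R_s^{ab}$ of the SBS-tier paths with access link of type $a$ and backhaul link of type $b$ is the largest $T\ge 0$ such that $T$ is at most the APT of the access links of type $a$ (density $\lambda_s$, bandwidth $\eta W$, coverage $P^{cov}_{s,a}(\gamma_0)$) and the part of $T$ that misses the cache, i.e. $T$ times the probability that the requested file is not stored in an SBS, is at most the APT of the backhaul links of type $b$ (density $\lambda_m$, bandwidth $(1-\eta)W$, coverage $P^{cov}_{bh,b}(\gamma_0)$). The APT $\mathcal R_s(\eta,C,\gamma_0)$ of the SBS tier is the largest total throughput that the four kinds of paths can carry under these constraints. **Claim.** The cache hit probability is $$p_h=\frac{\sum_{f=1}^{C}f^{-\gamma_p}}{\sum_{g=1}^{F}g^{-\gamma_p}}<1,$$ and, writing $l$ and $n$ for LoS and NLoS, first for the access link and then for the backhaul link, $$\mathcal R_s(\eta,C,\gamma_0)=\mathcal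 R_s^{ll}+\mathcal R_s^{ln}+\mathcal R_s^{nl}+\mathcal R_s^{nn},$$ where for all $a,b\in\{\mathrm L,\mathrm{NL}\}$ the largest $T$ above exists and $$\mathcal R_s^{ab}=\min\Big\{\lambda_s\,\eta W\log_2(1+\gamma_0)\,P^{cov}_{s,a}(\gamma_0),\ \frac{1}{1-p_h}\,\lambda_m W(1-\eta)\log_2(1+\gamma_0)\,P^{cov}_{bh,b}(\gamma_0)\Big\}.$$ -/

import Mathlib

open MeasureTheory ProbabilityTheory
open scoped ENNReal

noncomputable section

namespace MmWave

/-- The Euclidean plane; the receiver under study (typical user or typical small base station)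
always sits at the origin. -/
abbrev Plane := EuclideanSpace ℝ (Fin 2)

/-- Propagation state of a link: line of sight or non line of sight. -/
inductive Link
  | los
  | nlos

/-- Physical parameters of the two-tier network (small base stations `S`, macro base stations `M`):
densities, total bandwidth, noise power, path-loss constants and exponents, blockage parameter,
association biases, amplifier coefficients, total and fixed circuit powers, caching power
coefficient, size of the file library and Zipf exponent. The flag `instant` tells whether stations are selected
by the instantaneous received power (small-scale fading included) or by its mean over the fading,
which has mean one. -/
structure Params where
  (lamS lamM W N0 AL ANL aL aNL beta BS BM rhoS rhoM totS totM fcS fcM wca gammaP : ℝ)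
  files : ℕ
  instant : Bool
  lamS_pos : 0 < lamS
  lamM_pos : 0 < lamM
  W_pos : 0 < W
  N0_pos : 0 < N0
  AL_pos : 0 < AL
  ANL_pos : 0 < ANL
  aL_pos : 0 < aL
  aNL_pos : 0 < aNL
  beta_nonneg : 0 ≤ beta
  BS_pos : 0 < BS
  BM_pos : 0 < BM
  rhoS_pos : 0 < rhoS
  rhoM_pos : 0 < rhoM
  fcS_nonneg : 0 ≤ fcS
  fcM_nonneg : 0 ≤ fcM
  wca_nonneg : 0 ≤ wca
  gammaP_nonneg : 0 ≤ gammaP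
  /-- A macro station, which stores the whole library, has power left to transmit. -/
  macro_power : fcM + wca * files < totM

namespace Params

variable (p : Params)

/-- Transmit power of a small base station that caches `C` files. -/
def powS (C : ℕ) : ℝ := (p.totS - p.fcS - p.wca * C) / p.rhoS

/-- Transmit power of a macro base station, which caches the whole library. -/
def powM : ℝ := (p.totM - p.fcM - p.wca * p.files) / p.rhoM

/-- Probability that a link of length `r` is line of sight. -/
def probLos (r : ℝ) : ℝ :=
  min (18 / r) 1 * (1 - Real.exp (-p.beta * r)) + Real.exp (-p.beta * r)

/-- Path gain at distance `r`. -/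
def gain : Link → ℝ → ℝ
  | .los, r => p.AL * r ^ (-p.aL)
  | .nlos, r => p.ANL * r ^ (-p.aNL)

/-- Zipf popularity of the file of rank `f`. -/
def zipf (f : ℕ) : ℝ :=
  (f : ℝ) ^ (-p.gammaP) / ∑ g ∈ Finset.Icc 1 p.files, (g : ℝ) ^ (-p.gammaP)

end Params

variable {Ω : Type*}

/-- A random configuration of base stations as seen from the origin: positions, small-scale
fadings towards the origin, and auxiliary marks that decide the blockage of each link. -/
structure Field (Ω : Type*) where
  pos : ℕ → Ω → Plane
  fading : ℕ → Ω → ℝ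
  block : ℕ → Ω → ℝ

namespace Field

variable (Φ : Field Ω)

/-- Number of stations in the region `B`. -/
def count (B : Set Plane) (ω : Ω) : ℕ∞ := {i | Φ.pos i ω ∈ B}.encard

/-- All fadings and blockage marks, as one family of real random variables. -/
def mark : ℕ ⊕ ℕ → Ω → ℝ := Sum.elim Φ.fading Φ.block

/-- The complete description of the configuration as one random variable. -/
def data (ω : Ω) : (ℕ → Plane) × (ℕ ⊕ ℕ → ℝ) := (fun i => Φ.pos i ω, fun j => Φ.mark j ω)

open Classical in
/-- State of the link from station `i` to the origin: line of sight with probability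
`probLos (distance)`, independently over the stations. -/
def link (p : Params) (i : ℕ) (ω : Ω) : Link :=
  if Φ.block i ω ≤ p.probLos ‖Φ.pos i ω‖ then .los else .nlos

/-- Biased power received at the origin from station `i`, when every station of the configuration
transmits with power `P` and bias `B`. -/
def recv (p : Params) (P B : ℝ) (i : ℕ) (ω : Ω) : ℝ :=
  P * B * Φ.fading i ω * p.gain (Φ.link p i ω) ‖Φ.pos i ω‖

/-- Biased received power on which the choice of the serving station is based. -/
def assoc (p : Params) (P B : ℝ) (i : ℕ) (ω : Ω) : ℝ :=
  P * B * (if p.instant then Φ.fading i ω else 1) * p.gain (Φ.link p i ω) ‖Φ.pos i ω‖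

/-- The positions form a homogeneous Poisson point process of density `lam`; the fadings are
exponential of mean one (Rayleigh fading), the blockage marks uniform on `[0, 1]`, all marks are
independent and independent of the positions. -/
structure IsPoisson [MeasurableSpace Ω] (μ : Measure Ω) (lam : ℝ) : Prop where
  measurable_pos : ∀ i, Measurable (Φ.pos i)
  measurable_mark : ∀ j, Measurable (Φ.mark j)
  count_law : ∀ B : Set Plane, MeasurableSet B → volume B ≠ ∞ → ∀ n : ℕ,
    μ {ω | Φ.count B ω = n} = poissonMeasure (lam * (volume B).toReal).toNNReal {n}
  count_indep : ∀ (n : ℕ) (B : Fin n → Set Plane), (∀ j, MeasurableSet (B j)) →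
    Pairwise (fun j k => Disjoint (B j) (B k)) → iIndepFun (fun j => Φ.count (B j)) μ
  fading_law : ∀ i, μ.map (Φ.fading i) = expMeasure 1
  block_law : ∀ i, μ.map (Φ.block i) = volume.restrict (Set.Icc 0 1)
  mark_indep : iIndepFun Φ.mark μ
  pos_mark_indep : IndepFun (fun ω i => Φ.pos i ω) (fun ω j => Φ.mark j ω) μ

end Field

/-- The random objects: small and macro base stations seen from the typical user, macro base
stations seen from the typical small base station, and the rank of the requested file. -/
structure Network (Ω : Type*) where
  small : Field Ω
  large : Field Ω
  bh : Field Ω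
  request : Ω → ℕ

namespace Network

variable (N : Network Ω) [MeasurableSpace Ω] (μ : Measure Ω) (p : Params)

/-- The probabilistic assumptions of the network model. -/
structure IsModel : Prop where
  small_poisson : N.small.IsPoisson μ p.lamS
  large_poisson : N.large.IsPoisson μ p.lamM
  bh_poisson : N.bh.IsPoisson μ p.lamM
  tiers_indep : IndepFun N.small.data N.large.data μ
  measurable_request : Measurable N.request
  request_law : ∀ f ∈ Finset.Icc 1 p.files, μ.real {ω | N.request ω = f} = p.zipf f

/-- SINR of the typical user if served by the small station `i`: the interference comes from all
other small stations and from all macro stations. -/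
def sinrS (C i : ℕ) (ω : Ω) : ℝ≥0∞ :=
  ENNReal.ofReal (N.small.recv p (p.powS C) p.BS i ω) /
    ((∑' j : {j : ℕ // j ≠ i}, ENNReal.ofReal (N.small.recv p (p.powS C) p.BS j ω)) +
      (∑' l : ℕ, ENNReal.ofReal (N.large.recv p p.powM p.BM l ω)) + ENNReal.ofReal p.N0)

/-- SINR of the typical small station on the backhaul if served by the macro station `i`: the
interference comes from all other macro stations. -/
def sinrBh (i : ℕ) (ω : Ω) : ℝ≥0∞ :=
  ENNReal.ofReal (N.bh.recv p p.powM p.BM i ω) /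
    ((∑' j : {j : ℕ // j ≠ i}, ENNReal.ofReal (N.bh.recv p p.powM p.BM j ω)) +
      ENNReal.ofReal p.N0)

/-- The small station `i` serves the typical user: its biased received power is maximal among all
stations of both tiers. -/
def ServesS (C i : ℕ) (ω : Ω) : Prop :=
  (∀ j, N.small.assoc p (p.powS C) p.BS j ω ≤ N.small.assoc p (p.powS C) p.BS i ω) ∧
    ∀ l, N.large.assoc p p.powM p.BM l ω ≤ N.small.assoc p (p.powS C) p.BS i ω

/-- The macro station `i` serves the typical small station on the backhaul. -/
def ServesBh (i : ℕ) (ω : Ω) : Prop :=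
  ∀ j, N.bh.assoc p p.powM p.BM j ω ≤ N.bh.assoc p p.powM p.BM i ω

/-- Coverage probability of the access link in state `a`: the typical user is associated with a
small base station over a link in state `a`, and its SINR is at least `γ`. -/
def covS (C : ℕ) (a : Link) (γ : ℝ) : ℝ :=
  μ.real {ω | ∃ i, N.ServesS p C i ω ∧ N.small.link p i ω = a ∧
    ENNReal.ofReal γ ≤ N.sinrS p C i ω}

/-- Coverage probability of the backhaul link in state `b`: the typical small base station is
associated with a macro base station over a link in state `b`, and its SINR is at least `γ`. -/
def covBh (b : Link) (γ : ℝ) : ℝ :=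
  μ.real {ω | ∃ i, N.ServesBh p i ω ∧ N.bh.link p i ω = b ∧ ENNReal.ofReal γ ≤ N.sinrBh p i ω}

/-- Probability that the requested file is among the `C` most popular ones, which are exactly those
stored in each small base station. -/
def hitProb (C : ℕ) : ℝ := μ.real {ω | N.request ω ∈ Finset.Icc 1 C}

/-- Probability that the requested file has to be fetched over the backhaul. -/
def missProb (C : ℕ) : ℝ := μ.real {ω | N.request ω ∉ Finset.Icc 1 C}

/-- Average potential throughput of links of density `lam`, bandwidth `w`, SINR threshold `γ` and
coverage probability `c`. -/
def apt (lam w γ c : ℝ) : ℝ := lam * w * Real.logb 2 (1 + γ) * c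

/-- A throughput `T ≥ 0` of the SBS-tier path with access link in state `a` and backhaul link in
state `b` is supportable if the access link carries `T` and the backhaul link carries the part of
`T` that misses the cache. A fraction `η` of the bandwidth is given to the access links. -/
def Supportable (η : ℝ) (C : ℕ) (γ : ℝ) (a b : Link) (T : ℝ) : Prop :=
  0 ≤ T ∧ T ≤ apt p.lamS (η * p.W) γ (N.covS μ p C a γ) ∧
    N.missProb μ C * T ≤ apt p.lamM ((1 - η) * p.W) γ (N.covBh μ p b γ)

/-- Average potential throughput of the SBS-tier path in states `a` (access), `b` (backhaul). -/
def pathAPT (η : ℝ) (C : ℕ) (γ : ℝ) (a b : Link) : ℝ :=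
  sSup {T | N.Supportable μ p η C γ a b T}

/-- Average potential throughput of the SBS tier: the largest total throughput carried by the four
kinds of paths. -/
def sbsAPT (η : ℝ) (C : ℕ) (γ : ℝ) : ℝ :=
  sSup {R | ∃ T : Link → Link → ℝ, (∀ a b, N.Supportable μ p η C γ a b (T a b)) ∧
    R = T .los .los + T .los .nlos + T .nlos .los + T .nlos .nlos}

end Network

end MmWave

end

namespace MmWave

/-! Once the coverage probabilities are fixed, they act as nonnegative constants and the claim is a
small linear optimization. On each path, the backhaul constraint `m * T ≤ b` with miss probability
`m = 1 - p_h > 0` reads `T ≤ b / m`, so the feasible `T ≥ 0` form the interval from 0 to the minimum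
of two nonnegative bounds (`isGreatest_supportable`). Positivity of `m` is essential: it holds
because rank `p.files > C` has positive weight (`sum_popularity_lt`). The four paths share no
constraint, so the maximum of the sum is the sum of the maxima (`sbsAPT_eq_sum_pathAPT`). -/

/-- Normalization constant of the Zipf law. -/
theorem Params.zipf_normalizer_pos (p : Params) {C : ℕ} (hC : C < p.files) :
    0 < ∑ g ∈ Finset.Icc 1 p.files, (g : ℝ) ^ (-p.gammaP) :=
  Finset.sum_pos
    (fun g hg => Real.rpow_pos_of_pos (Nat.cast_pos.2 (Finset.mem_Icc.1 hg).1) _)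
    ⟨1, Finset.mem_Icc.2 ⟨le_rfl, by omega⟩⟩

/-- The `C` most popular files do not exhaust the library. -/
theorem Params.sum_popularity_lt (p : Params) {C : ℕ} (hC : C < p.files) :
    ∑ f ∈ Finset.Icc 1 C, (f : ℝ) ^ (-p.gammaP) <
      ∑ g ∈ Finset.Icc 1 p.files, (g : ℝ) ^ (-p.gammaP) :=
  -- Strictness comes from the least popular file, which is never cached.
  Finset.sum_lt_sum_of_subset (i := p.files) (Finset.Icc_subset_Icc_right hC.le)
    (Finset.mem_Icc.2 ⟨by omega, le_rfl⟩) (fun h => absurd (Finset.mem_Icc.1 h).2 (by omega))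
    (Real.rpow_pos_of_pos (Nat.cast_pos.2 (by omega)) _)
    (fun _ _ _ => Real.rpow_nonneg (Nat.cast_nonneg _) _)

namespace Network

variable {Ω : Type*} [MeasurableSpace Ω] {μ : Measure Ω} {p : Params} {N : Network Ω}

/-- The hit event is the disjoint union of the fibres of `N.request` over the cached ranks; all of
these lie in the library, where the Zipf law is prescribed. -/
theorem IsModel.hitProb_eq [IsFiniteMeasure μ] (hN : N.IsModel μ p) {C : ℕ} (hC : C < p.files) :
    N.hitProb μ C = (∑ f ∈ Finset.Icc 1 C, (f : ℝ) ^ (-p.gammaP)) /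
      ∑ g ∈ Finset.Icc 1 p.files, (g : ℝ) ^ (-p.gammaP) := by
  have h := sum_measureReal_preimage_singleton (μ := μ) (f := N.request) (Finset.Icc 1 C)
    (fun f _ => hN.measurable_request (measurableSet_singleton f))
  calc N.hitProb μ C = ∑ f ∈ Finset.Icc 1 C, μ.real (N.request ⁻¹' {f}) := h.symm
    _ = ∑ f ∈ Finset.Icc 1 C, p.zipf f := Finset.sum_congr rfl fun f hf =>
        hN.request_law f (Finset.Icc_subset_Icc_right hC.le hf)
    _ = _ := (Finset.sum_div _ _ _).symm

theorem IsModel.missProb_eq [IsProbabilityMeasure μ] (hN : N.IsModel μ p) (C : ℕ) :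
    N.missProb μ C = 1 - N.hitProb μ C :=
  probReal_compl_eq_one_sub (hN.measurable_request (Finset.Icc 1 C).measurableSet)

theorem apt_nonneg {lam w γ c : ℝ} (hlam : 0 ≤ lam) (hw : 0 ≤ w) (hγ : 0 ≤ γ) (hc : 0 ≤ c) :
    0 ≤ apt lam w γ c :=
  mul_nonneg (mul_nonneg (mul_nonneg hlam hw) (Real.logb_nonneg one_lt_two (by linarith))) hc

/-- The largest supportable throughput of a path is the smaller one of the access throughput and
of the backhaul throughput divided by the miss probability. -/
theorem isGreatest_supportable {η γ : ℝ} {C : ℕ} (hη : η ∈ Set.Icc (0 : ℝ) 1) (hγ : 0 ≤ γ)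
    (hmiss : 0 < N.missProb μ C) (a b : Link) :
    IsGreatest {T | N.Supportable μ p η C γ a b T}
      (min (apt p.lamS (η * p.W) γ (N.covS μ p C a γ))
        (apt p.lamM ((1 - η) * p.W) γ (N.covBh μ p b γ) / N.missProb μ C)) := by
  -- Feasibility includes `0 ≤ T`, so both bounds must be nonnegative; this is where `η ∈ [0, 1]`
  -- and `γ ≥ 0` enter.
  refine ⟨⟨le_min ?_ (div_nonneg ?_ hmiss.le), min_le_left _ _, ?_⟩, fun T hT =>
    le_min hT.2.1 ((le_div_iff₀' hmiss).2 hT.2.2)⟩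
  · exact apt_nonneg p.lamS_pos.le (mul_nonneg hη.1 p.W_pos.le) hγ measureReal_nonneg
  · exact apt_nonneg p.lamM_pos.le (mul_nonneg (sub_nonneg.2 hη.2) p.W_pos.le) hγ
      measureReal_nonneg
  · exact (le_div_iff₀' hmiss).1 (min_le_right _ _)

/-- The four kinds of paths attain their largest throughputs simultaneously. -/
theorem sbsAPT_eq_sum_pathAPT {η γ : ℝ} {C : ℕ}
    (h : ∀ a b, IsGreatest {T | N.Supportable μ p η C γ a b T} (N.pathAPT μ p η C γ a b)) :
    N.sbsAPT μ p η C γ =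
      N.pathAPT μ p η C γ .los .los + N.pathAPT μ p η C γ .los .nlos +
        N.pathAPT μ p η C γ .nlos .los + N.pathAPT μ p η C γ .nlos .nlos := by
  -- The four path maxima together are one admissible choice of `T`, since the constraints on `T a
  -- b` involve no other path.
  refine IsGreatest.csSup_eq ⟨⟨N.pathAPT μ p η C γ, fun a b => (h a b).1, rfl⟩, ?_⟩
  rintro _ ⟨T, hT, rfl⟩
  have hle := fun a b => (h a b).2 (hT a b)
  exact add_le_add (add_le_add (add_le_add (hle _ _) (hle _ _)) (hle _ _)) (hle _ _)

end Network

end MmWave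

open MmWave in
theorem mainTheorem7 {Ω : Type*} [MeasurableSpace Ω] (μ : Measure Ω) [IsProbabilityMeasure μ]
    (p : Params) (N : Network Ω) (hN : N.IsModel μ p)
    (η : ℝ) (hη : η ∈ Set.Icc (0 : ℝ) 1) (C : ℕ) (hC : C < p.files) (hpow : 0 ≤ p.powS C)
    (γ₀ : ℝ) (hγ₀ : 0 ≤ γ₀) :
    let p_h : ℝ := (∑ f ∈ Finset.Icc 1 C, (f : ℝ) ^ (-p.gammaP)) /
      ∑ g ∈ Finset.Icc 1 p.files, (g : ℝ) ^ (-p.gammaP)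
    let access : Link → ℝ := fun a =>
      p.lamS * η * p.W * Real.logb 2 (1 + γ₀) * N.covS μ p C a γ₀
    let backhaul : Link → ℝ := fun b =>
      1 / (1 - p_h) * p.lamM * p.W * (1 - η) * Real.logb 2 (1 + γ₀) * N.covBh μ p b γ₀
    N.hitProb μ C = p_h ∧ p_h < 1 ∧
    (∀ a b : Link, IsGreatest {T | N.Supportable μ p η C γ₀ a b T} (N.pathAPT μ p η C γ₀ a b) ∧
      N.pathAPT μ p η C γ₀ a b = min (access a) (backhaul b)) ∧
    N.sbsAPT μ p η C γ₀ =
      N.pathAPT μ p η C γ₀ .los .los + N.pathAPT μ p η C γ₀ .los .nlos +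
        N.pathAPT μ p η C γ₀ .nlos .los + N.pathAPT μ p η C γ₀ .nlos .nlos ∧
    N.sbsAPT μ p η C γ₀ =
      min (access .los) (backhaul .los) + min (access .los) (backhaul .nlos) +
        min (access .nlos) (backhaul .los) + min (access .nlos) (backhaul .nlos) := by
  intro p_h access backhaul
  have hhit : N.hitProb μ C = p_h := hN.hitProb_eq hC
  have hlt : p_h < 1 := (div_lt_one (p.zipf_normalizer_pos hC)).2 (p.sum_popularity_lt hC)
  have hmiss : N.missProb μ C = 1 - p_h := by rw [hN.missProb_eq, hhit]
  have hgreatest : ∀ a b : Link, IsGreatest {T | N.Supportable μ p η C γ₀ a b T}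
      (min (access a) (backhaul b)) := by
    intro a b
    -- What remains is to match the two arguments of `min`, with division by the miss probability
    -- rewritten as the factor `1 / (1 - p_h)`.
    convert Network.isGreatest_supportable hη hγ₀ (by rw [hmiss]; linarith) a b using 2
    · simp only [access, Network.apt]
      ring
    · simp only [backhaul, Network.apt, hmiss]
      ring
  have hpath : ∀ a b : Link, N.pathAPT μ p η C γ₀ a b = min (access a) (backhaul b) :=
    -- The attained maximum makes `sSup` a genuine value rather than the default 0 of an empty or
    -- unbounded set.
    fun a b => (hgreatest a b).csSup_eq
  have hattained : ∀ a b : Link, IsGreatest {T | N.Supportable μ p η C γ₀ a b T}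
      (N.pathAPT μ p η C γ₀ a b) := fun a b => by
    rw [hpath]
    exact hgreatest a b
  have hsum := Network.sbsAPT_eq_sum_pathAPT hattained
  refine ⟨hhit, hlt, fun a b => ⟨hattained a b, hpath a b⟩, hsum, ?_⟩
  rw [hsum]
  simp only [hpath]
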